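/- **Theorem.** Let $d\ge 0$ be an integer and $N>0$. Let $J=\begin{pmatrix}0&I_d\\-I_d&0\end{pmatrix}$, and let $H$ be a locally integrable function on $[0,N]$ whose values are (almost everywhere) positive semidefinite Hermitian complex $2d\times 2d$ matrices. Let $L^2(H,[0,N])$ be the space of measurable functions $f:[0,N]\to\mathbb C^{2d}$ with $\int_0^N f^*Hf\,dx<\infty$, where $f$ and $g$ are identified if $Hf=Hg$ almost everywhere, with the inner product $\langle f,g\rangle=\int_0^N f^*Hg\,dx$. Let $\theta_1,\theta_2,\beta_1,\beta_2\in\mathbb C^{d\times d}$ satisfy $$\theta_1\theta_1^*+\theta_2\theta_2^*=I,\quad \theta_1\theta_2^*-\theta_2\theta_1^*=0,\qquad \beta_1\beta_1^*+\beta_2\beta_2^*=I,\quad \beta_1\beta_2^*-\beta_2\beta_1^*=0,$$ and put $\Theta=(\theta_1,\theta_2)$, $B=(\beta_1,\beta_2)$, which are $d\times 2d$ matrices. Let $\mathcal T_{\Theta,B}$ be the linear relation on $L^2(H,[0,N])$ consisting of all pairs $(u,v)$ of elements of $L^2(H,[0,N])$ such that $u$ has a representative, again denoted $u$, which is absolutely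 continuous on $[0,N]$ and satisfies $$Ju'=Hv\ \text{ almost everywhere on }[0,N],\qquad \Theta u(0)=0,\qquad Bu(N)=0 .$$ Then $\mathcal T_{\Theta,B}$ is self-adjoint, that is, $\mathcal T_{\Theta,B}=\mathcal T_{\Theta,B}^*$, where $$\mathcal T_{\Theta,B}^*=\{(h,k)\in L^2(H,[0,N])^2:\ \langle h,g\rangle=\langle k,f\rangle\ \text{ for all }(f,g)\in\mathcal T_{\Theta,B}\}.$$ -/

import Mathlib

open MeasureTheory Set Matrix
open scoped ComplexOrder

noncomputable section

namespace CanonicalSystem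

/-- The vector space `ℂ^{2d}`, written as `ℂ^d ⊕ ℂ^d`. -/
abbrev Vec (d : ℕ) : Type := Fin d ⊕ Fin d → ℂ

/-- The standard symplectic matrix `J = (0 I; -I 0)` of size `2d × 2d`. -/
def J (d : ℕ) : Matrix (Fin d ⊕ Fin d) (Fin d ⊕ Fin d) ℂ :=
  Matrix.fromBlocks 0 1 (-1) 0

/-- A Hamiltonian on `[0, N]`: a locally integrable function whose values are (almost everywhere)
positive semidefinite Hermitian `2d × 2d` matrices. Only its values on `[0, N]` matter. -/
structure Hamiltonian (d : ℕ) (N : ℝ) where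
  /-- The matrix `H(x)`. -/
  mat : ℝ → Matrix (Fin d ⊕ Fin d) (Fin d ⊕ Fin d) ℂ
  locallyIntegrable : ∀ i j, LocallyIntegrableOn (fun x => mat x i j) (Icc 0 N)
  posSemidef : ∀ᵐ x ∂volume.restrict (Icc 0 N), (mat x).PosSemidef

variable {d : ℕ} {N : ℝ}

namespace Hamiltonian

/-- The pointwise form `f(x)^* H(x) g(x)`. -/
def form (H : Hamiltonian d N) (f g : ℝ → Vec d) (x : ℝ) : ℂ :=
  star (f x) ⬝ᵥ (H.mat x *ᵥ g x)

theorem integrable_mat (H : Hamiltonian d N) (i j : Fin d ⊕ Fin d) :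
    IntegrableOn (fun x => H.mat x i j) (Icc 0 N) :=
  (H.locallyIntegrable i j).integrableOn_isCompact isCompact_Icc

theorem form_add_left (H : Hamiltonian d N) (f g h : ℝ → Vec d) (x : ℝ) :
    H.form (f + g) h x = H.form f h x + H.form g h x := by
  simp [form, add_dotProduct]

theorem form_add_right (H : Hamiltonian d N) (f g h : ℝ → Vec d) (x : ℝ) :
    H.form f (g + h) x = H.form f g x + H.form f h x := by
  simp [form, mulVec_add, dotProduct_add]

theorem form_smul_left (H : Hamiltonian d N) (c : ℂ) (f g : ℝ → Vec d) (x : ℝ) :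
    H.form (c • f) g x = star c * H.form f g x := by
  simp [form, smul_dotProduct]

theorem form_smul_right (H : Hamiltonian d N) (c : ℂ) (f g : ℝ → Vec d) (x : ℝ) :
    H.form f (c • g) x = c * H.form f g x := by
  simp [form, mulVec_smul, dotProduct_smul]

theorem aestronglyMeasurable_form (H : Hamiltonian d N) {f g : ℝ → Vec d}
    (hf : AEStronglyMeasurable f (volume.restrict (Icc 0 N)))
    (hg : AEStronglyMeasurable g (volume.restrict (Icc 0 N))) :
    AEStronglyMeasurable (H.form f g) (volume.restrict (Icc 0 N)) := by
  have hf' : ∀ i, AEStronglyMeasurable (fun x => f x i) (volume.restrict (Icc 0 N)) :=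
    fun i => (continuous_apply i).comp_aestronglyMeasurable hf
  have hg' : ∀ i, AEStronglyMeasurable (fun x => g x i) (volume.restrict (Icc 0 N)) :=
    fun i => (continuous_apply i).comp_aestronglyMeasurable hg
  change AEStronglyMeasurable
    (fun x => ∑ i, star (f x i) * ∑ j, H.mat x i j * g x j) (volume.restrict (Icc 0 N))
  refine Finset.aestronglyMeasurable_fun_sum _ fun i _ => ?_
  refine (continuous_star.comp_aestronglyMeasurable (hf' i)).mul ?_
  exact Finset.aestronglyMeasurable_fun_sum _ fun j _ =>
    (H.integrable_mat i j).aestronglyMeasurable.mul (hg' j)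

theorem star_form (H : Hamiltonian d N) (f g : ℝ → Vec d) {x : ℝ}
    (hx : (H.mat x).PosSemidef) : star (H.form g f x) = H.form f g x := by
  have h1 : (H.mat x)ᴴ = H.mat x := hx.isHermitian
  simp only [form]
  rw [star_dotProduct, star_mulVec, h1, ← dotProduct_mulVec, star_star]

theorem form_self_nonneg (H : Hamiltonian d N) (f : ℝ → Vec d) {x : ℝ}
    (hx : (H.mat x).PosSemidef) : 0 ≤ H.form f f x :=
  hx.dotProduct_mulVec_nonneg (f x)

theorem norm_form_le (H : Hamiltonian d N) (f g : ℝ → Vec d) {x : ℝ}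
    (hx : (H.mat x).PosSemidef) :
    ‖H.form f g x‖ ≤ ‖H.form f f x‖ + ‖H.form g g x‖ := by
  obtain ⟨c, hc, hc'⟩ := RCLike.exists_norm_eq_mul_self (H.form f g x)
  have h0 := H.form_self_nonneg (f + (-c) • g) hx
  have hcc : star c * c = 1 := by
    have := Complex.normSq_eq_conj_mul_self (z := c)
    rw [Complex.normSq_eq_norm_sq, hc] at this
    simpa using this.symm
  have hgf : H.form g f x = star (H.form f g x) := (H.star_form g f hx).symm
  have hs : star c * H.form g f x = (‖H.form f g x‖ : ℂ) := by
    rw [hgf, ← star_mul', ← hc']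
    exact Complex.conj_ofReal _
  have hexp : H.form (f + (-c) • g) (f + (-c) • g) x =
      H.form f f x + H.form g g x - 2 * (‖H.form f g x‖ : ℂ) := by
    rw [form_add_left, form_add_right, form_add_right, form_smul_left, form_smul_left,
      form_smul_right, form_smul_right, star_neg]
    have hc'' : c * H.form f g x = (‖H.form f g x‖ : ℂ) := hc'.symm
    linear_combination (-1 : ℂ) * hc'' - hs + H.form g g x * hcc
  rw [hexp] at h0
  have h1 := (Complex.le_def.1 h0).1
  have h2 := Complex.re_le_norm (H.form f f x)
  have h3 := Complex.re_le_norm (H.form g g x)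
  simp at h1
  nlinarith [norm_nonneg (H.form f g x)]

/-- Measurable `f` with `∫₀ᴺ f^* H f < ∞`. -/
def SqIntegrable (H : Hamiltonian d N) (f : ℝ → Vec d) : Prop :=
  AEStronglyMeasurable f (volume.restrict (Icc 0 N)) ∧ IntegrableOn (H.form f f) (Icc 0 N)

theorem integrable_form (H : Hamiltonian d N) {f g : ℝ → Vec d}
    (hf : H.SqIntegrable f) (hg : H.SqIntegrable g) : IntegrableOn (H.form f g) (Icc 0 N) := by
  refine (hf.2.norm.add hg.2.norm).mono' (H.aestronglyMeasurable_form hf.1 hg.1) ?_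
  filter_upwards [H.posSemidef] with x hx
  exact H.norm_form_le f g hx

/-- The complex vector space of square integrable functions (before identification). -/
def sqIntegrableSubmodule (H : Hamiltonian d N) : Submodule ℂ (ℝ → Vec d) where
  carrier := {f | H.SqIntegrable f}
  zero_mem' := by
    refine ⟨aestronglyMeasurable_zero, ?_⟩
    have : H.form 0 0 = fun _ => 0 := by ext x; simp [form]
    rw [this]
    exact integrableOn_zero
  add_mem' := by
    intro f g hf hg
    refine ⟨hf.1.add hg.1, ?_⟩
    have : H.form (f + g) (f + g) =
        (H.form f f + H.form f g) + (H.form g f + H.form g g) := by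
      ext x; simp [form_add_left, form_add_right]; ring
    rw [this]
    exact ((H.integrable_form hf hf).add (H.integrable_form hf hg)).add
      ((H.integrable_form hg hf).add (H.integrable_form hg hg))
  smul_mem' := by
    intro c f hf
    refine ⟨hf.1.const_smul c, ?_⟩
    have : H.form (c • f) (c • f) = fun x => (star c * c) * H.form f f x := by
      ext x; simp [form_smul_left, form_smul_right]; ring
    rw [this]
    exact hf.2.const_mul _

/-- The square integrable functions, as a type carrying the semi-inner product
`⟨f, g⟩ = ∫₀ᴺ f^* H g`. -/
def PreL2 (H : Hamiltonian d N) : Type := H.sqIntegrableSubmodule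

namespace PreL2

variable {H : Hamiltonian d N}

instance : AddCommGroup (PreL2 H) := inferInstanceAs (AddCommGroup H.sqIntegrableSubmodule)

instance : Module ℂ (PreL2 H) := inferInstanceAs (Module ℂ H.sqIntegrableSubmodule)

/-- The underlying function. -/
def toFun (f : PreL2 H) : ℝ → Vec d := f.1

instance : CoeFun (PreL2 H) (fun _ => ℝ → Vec d) := ⟨toFun⟩

theorem sqIntegrable (f : PreL2 H) : H.SqIntegrable f := f.2

theorem coe_add (f g : PreL2 H) : (f + g).toFun = f.toFun + g.toFun := rfl

theorem coe_smul (c : ℂ) (f : PreL2 H) : (c • f).toFun = c • f.toFun := rfl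

theorem coe_zero : ((0 : PreL2 H).toFun) = 0 := rfl

theorem coe_sub (f g : PreL2 H) : (f - g).toFun = f.toFun - g.toFun := rfl

/-- The semi-inner product `⟨f, g⟩ = ∫₀ᴺ f(x)^* H(x) g(x) dx`. -/
instance core : PreInnerProductSpace.Core ℂ (PreL2 H) where
  inner f g := ∫ x in Icc 0 N, H.form f g x
  conj_inner_symm f g := by
    rw [← integral_conj]
    refine integral_congr_ae ?_
    filter_upwards [H.posSemidef] with x hx
    exact H.star_form f g hx
  re_inner_nonneg f := by
    rw [← integral_re (H.integrable_form f.sqIntegrable f.sqIntegrable)]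
    refine integral_nonneg_of_ae ?_
    filter_upwards [H.posSemidef] with x hx
    exact (Complex.le_def.1 (H.form_self_nonneg f hx)).1
  add_left f g h := by
    rw [← integral_add (H.integrable_form f.sqIntegrable h.sqIntegrable)
      (H.integrable_form g.sqIntegrable h.sqIntegrable)]
    refine integral_congr_ae (Filter.Eventually.of_forall fun x => ?_)
    exact H.form_add_left f g h x
  smul_left f g c := by
    rw [← integral_const_mul]
    refine integral_congr_ae (Filter.Eventually.of_forall fun x => ?_)
    exact H.form_smul_left c f g x

instance : SeminormedAddCommGroup (PreL2 H) :=
  InnerProductSpace.Core.toSeminormedAddCommGroup (𝕜 := ℂ)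

instance : InnerProductSpace ℂ (PreL2 H) := InnerProductSpace.ofCore core

theorem inner_def (f g : PreL2 H) :
    inner ℂ f g = ∫ x in Icc 0 N, star (f x) ⬝ᵥ (H.mat x *ᵥ g x) := rfl

end PreL2

/-- The space `L²(H, [0, N])`: square integrable functions modulo those of seminorm zero. -/
abbrev L2 (H : Hamiltonian d N) : Type := SeparationQuotient (PreL2 H)

/-- The class in `L²(H, [0, N])` of a square integrable function. -/
def toL2 (H : Hamiltonian d N) (f : PreL2 H) : L2 H := SeparationQuotient.mk f

/-- Two functions are identified in `L²(H, [0, N])` exactly when `H f = H g` almost everywhere. -/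
theorem toL2_eq_toL2_iff (H : Hamiltonian d N) (f g : PreL2 H) :
    H.toL2 f = H.toL2 g ↔
      ∀ᵐ x ∂volume.restrict (Icc 0 N), H.mat x *ᵥ f x = H.mat x *ᵥ g x := by
  have h1 : H.toL2 f = H.toL2 g ↔ inner ℂ (f - g) (f - g) = 0 := by
    rw [toL2, toL2, SeparationQuotient.mk_eq_mk, Metric.inseparable_iff, dist_eq_norm,
      inner_self_eq_norm_sq_to_K]
    simp
  have h2 : inner ℂ (f - g) (f - g) = 0 ↔
      ∀ᵐ x ∂volume.restrict (Icc 0 N), H.form (f - g).toFun (f - g).toFun x = 0 := by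
    have hi := H.integrable_form (f - g).sqIntegrable (f - g).sqIntegrable
    have hre : (fun x => H.form (f - g).toFun (f - g).toFun x)
        =ᵐ[volume.restrict (Icc 0 N)]
        fun x => (((H.form (f - g).toFun (f - g).toFun x).re : ℝ) : ℂ) := by
      filter_upwards [H.posSemidef] with x hx
      have := (Complex.le_def.1 (H.form_self_nonneg (f - g).toFun hx)).2
      exact Complex.ext (by simp) (by simpa using this.symm)
    rw [PreL2.inner_def]
    change (∫ x in Icc 0 N, H.form (f - g).toFun (f - g).toFun x) = 0 ↔ _
    rw [integral_congr_ae hre, integral_complex_ofReal, Complex.ofReal_eq_zero,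
      integral_eq_zero_iff_of_nonneg_ae ?_ (f := fun x => (H.form (f - g).toFun (f - g).toFun x).re)
        hi.re]
    · constructor
      · intro h
        filter_upwards [h, hre] with x hx hx'
        rw [hx']
        simpa using hx
      · intro h
        filter_upwards [h] with x hx
        simp [hx]
    · filter_upwards [H.posSemidef] with x hx
      exact (Complex.le_def.1 (H.form_self_nonneg (f - g).toFun hx)).1
  rw [h1, h2]
  refine Filter.eventually_congr ?_
  filter_upwards [H.posSemidef] with x hx
  rw [form, hx.dotProduct_mulVec_zero_iff, PreL2.coe_sub, Pi.sub_apply, mulVec_sub, sub_eq_zero]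

end Hamiltonian

/-- `(θ₁, θ₂)` belongs to the set of admissible boundary matrices. -/
def IsBoundaryMatrix (θ₁ θ₂ : Matrix (Fin d) (Fin d) ℂ) : Prop :=
  θ₁ * θ₁ᴴ + θ₂ * θ₂ᴴ = 1 ∧ θ₁ * θ₂ᴴ - θ₂ * θ₁ᴴ = 0

/-- `u` is absolutely continuous on `[0, N]`, satisfies `J u' = H v` almost everywhere there, and
`(θ₁, θ₂) u(0) = 0`, `(β₁, β₂) u(N) = 0`. -/
structure IsSolution (H : Hamiltonian d N) (θ₁ θ₂ β₁ β₂ : Matrix (Fin d) (Fin d) ℂ)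
    (u v : ℝ → Vec d) : Prop where
  absolutelyContinuous : AbsolutelyContinuousOnInterval u 0 N
  equation : ∀ᵐ x ∂volume.restrict (Icc 0 N),
    DifferentiableAt ℝ u x ∧ J d *ᵥ deriv u x = H.mat x *ᵥ v x
  left_boundary : Matrix.fromCols θ₁ θ₂ *ᵥ u 0 = 0
  right_boundary : Matrix.fromCols β₁ β₂ *ᵥ u N = 0

/-- The linear relation `T_{Θ,B}` on `L²(H, [0, N])`: all pairs of classes for which the first has
an absolutely continuous representative `u` with `J u' = H v` almost everywhere, where `v`
represents the second, and with `(θ₁, θ₂) u(0) = 0` and `(β₁, β₂) u(N) = 0`. -/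
def boundaryRelation (H : Hamiltonian d N) (θ₁ θ₂ β₁ β₂ : Matrix (Fin d) (Fin d) ℂ) :
    Submodule ℂ (H.L2 × H.L2) where
  carrier := {p | ∃ u v : H.PreL2,
    H.toL2 u = p.1 ∧ H.toL2 v = p.2 ∧ IsSolution H θ₁ θ₂ β₁ β₂ u v}
  zero_mem' := by
    refine ⟨0, 0, rfl, rfl, ?_, ?_, ?_, ?_⟩
    · exact (LipschitzWith.const (0 : Vec d)).lipschitzOnWith.absolutelyContinuousOnInterval
    · refine Filter.Eventually.of_forall fun x => ⟨differentiableAt_const (0 : Vec d), ?_⟩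
      have : deriv (fun _ : ℝ => (0 : Vec d)) x = 0 := deriv_const x _
      rw [Hamiltonian.PreL2.coe_zero, Pi.zero_apply, mulVec_zero]
      exact (congrArg (J d *ᵥ ·) this).trans (mulVec_zero _)
    · rw [Hamiltonian.PreL2.coe_zero, Pi.zero_apply, mulVec_zero]
    · rw [Hamiltonian.PreL2.coe_zero, Pi.zero_apply, mulVec_zero]
  add_mem' := by
    rintro p q ⟨u, v, hu, hv, hs⟩ ⟨u', v', hu', hv', hs'⟩
    refine ⟨u + u', v + v', ?_, ?_, ?_, ?_, ?_, ?_⟩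
    · rw [Prod.fst_add, ← hu, ← hu']; rfl
    · rw [Prod.snd_add, ← hv, ← hv']; rfl
    · exact hs.absolutelyContinuous.add hs'.absolutelyContinuous
    · filter_upwards [hs.equation, hs'.equation] with x hx hx'
      rw [Hamiltonian.PreL2.coe_add, Hamiltonian.PreL2.coe_add]
      refine ⟨hx.1.add hx'.1, ?_⟩
      rw [deriv_add hx.1 hx'.1, Pi.add_apply, mulVec_add, mulVec_add, hx.2, hx'.2]
    · rw [Hamiltonian.PreL2.coe_add, Pi.add_apply, mulVec_add, hs.left_boundary,
        hs'.left_boundary, add_zero]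
    · rw [Hamiltonian.PreL2.coe_add, Pi.add_apply, mulVec_add, hs.right_boundary,
        hs'.right_boundary, add_zero]
  smul_mem' := by
    rintro c p ⟨u, v, hu, hv, hs⟩
    refine ⟨c • u, c • v, ?_, ?_, ?_, ?_, ?_, ?_⟩
    · rw [Prod.smul_fst, ← hu]; rfl
    · rw [Prod.smul_snd, ← hv]; rfl
    · exact hs.absolutelyContinuous.const_smul c
    · filter_upwards [hs.equation] with x hx
      rw [Hamiltonian.PreL2.coe_smul, Hamiltonian.PreL2.coe_smul]
      refine ⟨hx.1.const_smul c, ?_⟩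
      rw [deriv_const_smul c hx.1, Pi.smul_apply, mulVec_smul, mulVec_smul, hx.2]
    · rw [Hamiltonian.PreL2.coe_smul, Pi.smul_apply, mulVec_smul, hs.left_boundary, smul_zero]
    · rw [Hamiltonian.PreL2.coe_smul, Pi.smul_apply, mulVec_smul, hs.right_boundary, smul_zero]

/-- A linear relation is self-adjoint if it equals its adjoint
`{(h, k) | ⟨h, g⟩ = ⟨k, f⟩ for all (f, g) in the relation}`. -/
def IsSelfAdjointRelation {E : Type*} [NormedAddCommGroup E] [InnerProductSpace ℂ E]
    (T : Submodule ℂ (E × E)) : Prop :=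
  T.adjoint = T

end CanonicalSystem

end

/-! Symmetry is integration by parts. Green's identity `inner_sub_inner_eq` reduces the defect of
symmetry to the symplectic form at the two endpoints, and each endpoint term vanishes because the
kernel of an admissible boundary matrix is isotropic.

For the reverse inclusion, solutions of `J u' = H g` are parametrised freely by `a = u(0)` and `g`,
with `u(N) = a - J ∫ H g`. Given `(h, k)` in the adjoint, let `w` solve `J w' = H k`, `w(0) = 0`. By
Green, the functional `⟨w - h, g⟩ - w(N)^* J u(N)` of `(a, g)` vanishes whenever `Θ u(0) = 0` and `B
u(N) = 0`. These are finitely many linear conditions, so it equals `s^* Θ u(0) + t^* B u(N)` for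
some multipliers `s, t` (`exists_multipliers`). Taking `g = 0` gives `J w(N) = Θ^* s + B^* t`;
taking `a = 0` gives `h = w + J Θ^* s` in `L²`. This representative has boundary values `J Θ^* s`
and `-J B^* t`, which are admissible since `Θ J Θ^* = 0` and `B J B^* = 0`. Neither density of the
domain nor definiteness of `H` is needed. -/

namespace AbsolutelyContinuousOnInterval

/-! ### Vector-valued absolutely continuous functions. -/

/-- A function whose increments are controlled by those of an absolutely continuous function is
absolutely continuous. -/
theorem of_dist_le {X Y : Type*} [PseudoMetricSpace X] [PseudoMetricSpace Y] {f : ℝ → X}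
    {g : ℝ → Y} {a b C : ℝ} (hf : AbsolutelyContinuousOnInterval f a b)
    (h : ∀ x ∈ uIcc a b, ∀ y ∈ uIcc a b, dist (g x) (g y) ≤ C * dist (f x) (f y)) :
    AbsolutelyContinuousOnInterval g a b := by
  unfold AbsolutelyContinuousOnInterval at hf ⊢
  refine squeeze_zero' ?_ ?_ (by simpa using hf.const_mul C)
  · exact Filter.Eventually.of_forall fun _ => Finset.sum_nonneg fun i _ => dist_nonneg
  · rw [Filter.eventually_inf_principal]
    filter_upwards with E hE
    rw [Finset.mul_sum]
    exact Finset.sum_le_sum fun i hi => h _ (hE.1 i hi).1 _ (hE.1 i hi).2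

theorem sum {ι F : Type*} [NormedAddCommGroup F] {f : ι → ℝ → F} {a b : ℝ} (s : Finset ι)
    (hf : ∀ i ∈ s, AbsolutelyContinuousOnInterval (f i) a b) :
    AbsolutelyContinuousOnInterval (fun x => ∑ i ∈ s, f i x) a b := by
  classical
  induction s using Finset.induction_on with
  | empty =>
    simpa using (LipschitzWith.const (0 : F)).lipschitzOnWith.absolutelyContinuousOnInterval
  | insert i s hi ih =>
    simp only [Finset.sum_insert hi]
    exact (hf i (by simp)).fun_add (ih fun j hj => hf j (by simp [hj]))

theorem apply {ι : Type*} [Fintype ι] {F : ι → Type*} [∀ i, PseudoMetricSpace (F i)]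
    {f : ℝ → ∀ i, F i} {a b : ℝ} (hf : AbsolutelyContinuousOnInterval f a b) (i : ι) :
    AbsolutelyContinuousOnInterval (fun x => f x i) a b :=
  hf.of_dist_le (C := 1) fun x _ y _ => by simpa using dist_le_pi_dist (f x) (f y) i

theorem dotProduct {ι : Type*} [Fintype ι] {f g : ℝ → ι → ℂ} {a b : ℝ}
    (hf : AbsolutelyContinuousOnInterval f a b) (hg : AbsolutelyContinuousOnInterval g a b) :
    AbsolutelyContinuousOnInterval (fun x => f x ⬝ᵥ g x) a b :=
  sum _ fun i _ => (hf.apply i).fun_smul (hg.apply i)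

theorem star {ι : Type*} [Fintype ι] {f : ℝ → ι → ℂ} {a b : ℝ}
    (hf : AbsolutelyContinuousOnInterval f a b) :
    AbsolutelyContinuousOnInterval (fun x => star (f x)) a b :=
  hf.of_dist_le (C := 1) fun x _ y _ => by
    rw [dist_eq_norm, dist_eq_norm, ← star_sub, norm_star, one_mul]

theorem mulVec {m n : Type*} [Fintype m] [Fintype n] {f : ℝ → n → ℂ} {a b : ℝ}
    (hf : AbsolutelyContinuousOnInterval f a b) (A : Matrix m n ℂ) :
    AbsolutelyContinuousOnInterval (fun x => A *ᵥ f x) a b := by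
  let L : (n → ℂ) →L[ℂ] (m → ℂ) := LinearMap.toContinuousLinearMap A.mulVecLin
  refine hf.of_dist_le (C := ‖L‖) fun x _ y _ => ?_
  rw [dist_eq_norm, dist_eq_norm, ← mulVec_sub]
  exact L.le_opNorm (f x - f y)

variable {E : Type*} [NormedAddCommGroup E] [NormedSpace ℝ E]

/-- The indefinite integral of a vector valued integrable function is absolutely continuous. -/
theorem _root_.IntervalIntegrable.absolutelyContinuousOnInterval_integral {f : ℝ → E} {a b : ℝ}
    (h : IntervalIntegrable f volume a b) :
    AbsolutelyContinuousOnInterval (fun x => ∫ v in a..x, f v) a b := by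
  refine (h.norm.absolutelyContinuousOnInterval_intervalIntegral left_mem_uIcc).of_dist_le
    (C := 1) fun x hx y hy => ?_
  have hx' := h.mono_set (uIcc_subset_uIcc_left hx)
  have hy' := h.mono_set (uIcc_subset_uIcc_left hy)
  rw [dist_eq_norm, dist_eq_norm, intervalIntegral.integral_interval_sub_left hx' hy',
    intervalIntegral.integral_interval_sub_left hx'.norm hy'.norm, one_mul, Real.norm_eq_abs]
  exact intervalIntegral.norm_integral_le_abs_integral_norm

/-- The fundamental theorem of calculus for vector valued absolutely continuous functions. -/
theorem integral_eq_sub_of_ae_hasDerivAt [CompleteSpace E] {f f' : ℝ → E} {a b : ℝ}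
    (hf : AbsolutelyContinuousOnInterval f a b) (hf' : IntervalIntegrable f' volume a b)
    (h : ∀ᵐ x, x ∈ uIcc a b → HasDerivAt f (f' x) x) :
    ∫ x in a..b, f' x = f b - f a := by
  -- Subtracting the indefinite integral leaves an absolutely continuous function with derivative
  -- zero almost everywhere, hence a constant.
  have hg : ∀ᵐ x, x ∈ uIcc a b → HasDerivAt (fun x => f x - ∫ v in a..x, f' v) 0 x := by
    filter_upwards [h, hf'.ae_hasDerivAt_integral] with x hx hx' hxm
    simpa using (hx hxm).fun_sub (hx' hxm a left_mem_uIcc)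
  obtain ⟨C, hC⟩ :=
    (hf.fun_sub hf'.absolutelyContinuousOnInterval_integral).const_of_ae_hasDerivAt_zero hg
  have ha := hC a left_mem_uIcc
  have hb := hC b right_mem_uIcc
  simp only [intervalIntegral.integral_same, sub_zero] at ha
  rw [ha, ← hb]
  abel

end AbsolutelyContinuousOnInterval

theorem HasDerivAt.dotProduct {ι : Type*} [Fintype ι] {f g : ℝ → ι → ℂ} {f' g' : ι → ℂ} {x : ℝ}
    (hf : HasDerivAt f f' x) (hg : HasDerivAt g g' x) :
    HasDerivAt (fun y => f y ⬝ᵥ g y) (f' ⬝ᵥ g x + f x ⬝ᵥ g') x := by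
  rw [hasDerivAt_pi] at hf hg
  have := HasDerivAt.fun_sum fun i (_ : i ∈ Finset.univ) => (hf i).mul (hg i)
  rw [Finset.sum_add_distrib] at this
  exact this

theorem HasDerivAt.mulVec {m n : Type*} [Fintype m] [Fintype n] {f : ℝ → n → ℂ} {f' : n → ℂ}
    {x : ℝ} (hf : HasDerivAt f f' x) (A : Matrix m n ℂ) :
    HasDerivAt (fun y => A *ᵥ f y) (A *ᵥ f') x :=
  ((LinearMap.toContinuousLinearMap A.mulVecLin).restrictScalars ℝ).hasFDerivAt.comp_hasDerivAt x hf

noncomputable section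

namespace CanonicalSystem

variable {d : ℕ} {N : ℝ}

/-! ### Symplectic linear algebra of boundary matrices. -/

theorem J_mul_J : J d * J d = -1 := by
  simp [J, fromBlocks_multiply, ← fromBlocks_one, fromBlocks_neg]

theorem J_mulVec_J_mulVec (v : Vec d) : J d *ᵥ (J d *ᵥ v) = -v := by
  rw [mulVec_mulVec, J_mul_J, neg_mulVec, one_mulVec]

theorem J_conjTranspose : (J d)ᴴ = -J d := by
  simp [J, fromBlocks_conjTranspose, fromBlocks_neg]

theorem star_J_mulVec (v : Vec d) : star (J d *ᵥ v) = -(star v ᵥ* J d) := by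
  rw [star_mulVec, J_conjTranspose, vecMul_neg]

theorem star_J_mulVec_dotProduct (u v : Vec d) :
    star (J d *ᵥ u) ⬝ᵥ v = -(star u ⬝ᵥ (J d *ᵥ v)) := by
  rw [star_J_mulVec, neg_dotProduct, dotProduct_mulVec]

section BoundaryMatrix

variable {θ₁ θ₂ : Matrix (Fin d) (Fin d) ℂ}

theorem IsBoundaryMatrix.mul_conjTranspose (h : IsBoundaryMatrix θ₁ θ₂) :
    fromCols θ₁ θ₂ * (fromCols θ₁ θ₂)ᴴ = 1 := by
  rw [conjTranspose_fromCols_eq_fromRows_conjTranspose, fromCols_mul_fromRows, h.1]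

theorem IsBoundaryMatrix.mul_J_mul_conjTranspose (h : IsBoundaryMatrix θ₁ θ₂) :
    fromCols θ₁ θ₂ * J d * (fromCols θ₁ θ₂)ᴴ = 0 := by
  have h2 : fromCols θ₁ θ₂ * J d = fromCols (-θ₂) θ₁ := by
    rw [J, fromCols_mul_fromBlocks]
    simp
  rw [h2, conjTranspose_fromCols_eq_fromRows_conjTranspose, fromCols_mul_fromRows, neg_mul,
    neg_add_eq_sub, h.2]

/-- The rows of `Θ` and `Θ J` together form an orthonormal basis. -/
theorem IsBoundaryMatrix.conjTranspose_mul_add (h : IsBoundaryMatrix θ₁ θ₂) :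
    (fromCols θ₁ θ₂)ᴴ * fromCols θ₁ θ₂ +
      (fromCols θ₁ θ₂ * J d)ᴴ * (fromCols θ₁ θ₂ * J d) = 1 := by
  set T := fromCols θ₁ θ₂
  have h1 : T * Tᴴ = 1 := h.mul_conjTranspose
  have h2 : T * J d * Tᴴ = 0 := h.mul_J_mul_conjTranspose
  -- The stacked matrix is square, so its right inverse is also a left inverse; this is where the
  -- number of boundary conditions being half the dimension enters.
  have h3 : fromRows T (T * J d) * (fromRows T (T * J d))ᴴ = 1 := by
    rw [conjTranspose_fromRows_eq_fromCols_conjTranspose, fromRows_mul_fromCols,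
      conjTranspose_mul, J_conjTranspose, h1, h2, Matrix.neg_mul, Matrix.mul_neg, Matrix.mul_neg,
      ← Matrix.mul_assoc, h2, Matrix.mul_assoc T, ← Matrix.mul_assoc (J d), J_mul_J,
      Matrix.neg_mul, Matrix.one_mul, Matrix.mul_neg, h1, neg_neg, neg_zero, fromBlocks_one]
  rw [mul_eq_one_comm, conjTranspose_fromRows_eq_fromCols_conjTranspose,
    fromCols_mul_fromRows] at h3
  exact h3

/-- The kernel of an admissible boundary matrix is isotropic for the symplectic form. -/
theorem IsBoundaryMatrix.star_dotProduct_J_mulVec_eq_zero (h : IsBoundaryMatrix θ₁ θ₂)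
    {u v : Vec d} (hu : fromCols θ₁ θ₂ *ᵥ u = 0) (hv : fromCols θ₁ θ₂ *ᵥ v = 0) :
    star u ⬝ᵥ (J d *ᵥ v) = 0 := by
  -- Insert the resolution of the identity between `u^*` and `J v`: the `Θ J` part dies since `Θ J J
  -- v = -Θ v = 0`, the `Θ` part since `Θ u = 0`.
  have h1 := congrArg (fun M => star u ⬝ᵥ (M *ᵥ (J d *ᵥ v))) h.conjTranspose_mul_add
  simp only [one_mulVec, add_mulVec, ← mulVec_mulVec, J_mulVec_J_mulVec,
    mulVec_neg, hv, mulVec_zero, neg_zero, add_zero] at h1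
  rw [← h1, dotProduct_mulVec, ← star_mulVec, hu, star_zero, zero_dotProduct]

/-- `J Θ^*` maps into the kernel of `Θ`. -/
theorem IsBoundaryMatrix.mulVec_J_conjTranspose_mulVec (h : IsBoundaryMatrix θ₁ θ₂)
    (s : Fin d → ℂ) : fromCols θ₁ θ₂ *ᵥ (J d *ᵥ ((fromCols θ₁ θ₂)ᴴ *ᵥ s)) = 0 := by
  rw [mulVec_mulVec, mulVec_mulVec, h.mul_J_mul_conjTranspose, zero_mulVec]

end BoundaryMatrix

/-! ### Integrability, Green's identity and the initial value problem. -/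

namespace Hamiltonian

variable (H : Hamiltonian d N)

theorem sqIntegrable_of_continuousOn {u : ℝ → Vec d} (hu : ContinuousOn u (Icc 0 N)) :
    H.SqIntegrable u := by
  refine ⟨hu.aestronglyMeasurable measurableSet_Icc, ?_⟩
  have hu' : ∀ i, ContinuousOn (fun x => u x i) (Icc 0 N) := fun i =>
    (continuous_apply i).comp_continuousOn hu
  change IntegrableOn (fun x => ∑ i, star (u x i) * ∑ j, H.mat x i j * u x j) (Icc 0 N)
  refine integrable_finsetSum _ fun i _ => ?_
  refine IntegrableOn.continuousOn_mul (continuous_star.comp_continuousOn (hu' i)) ?_ isCompact_Icc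
  exact integrable_finsetSum _ fun j _ =>
    (H.integrable_mat i j).mul_continuousOn (hu' j) isCompact_Icc

/-- Each entry of `H g` is the form of a constant basis vector with `g`, and constants are square
integrable because `H` is integrable. Thus `H g` has a primitive even when `g` itself is not
integrable. -/
theorem integrable_mulVec {g : ℝ → Vec d} (hg : H.SqIntegrable g) :
    IntegrableOn (fun x => H.mat x *ᵥ g x) (Icc 0 N) := by
  refine Integrable.of_eval fun i => ?_
  have h := H.integrable_form (H.sqIntegrable_of_continuousOn
    (continuousOn_const (c := (Pi.single i 1 : Vec d)))) hg
  refine h.congr (Filter.Eventually.of_forall fun x => ?_)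
  simp [form, Pi.star_single]

namespace PreL2

variable {H}

/-- A continuous function, as an element of `PreL2 H`. -/
def ofContinuousOn (u : ℝ → Vec d) (hu : ContinuousOn u (Icc 0 N)) : PreL2 H :=
  ⟨u, H.sqIntegrable_of_continuousOn hu⟩

/-- A constant function, as an element of `PreL2 H`. -/
def const (a : Vec d) : PreL2 H := ofContinuousOn (fun _ => a) continuousOn_const

theorem intervalIntegrable_mulVec (hN : 0 ≤ N) (g : PreL2 H) :
    IntervalIntegrable (fun x => H.mat x *ᵥ g x) volume 0 N := by
  rw [intervalIntegrable_iff_integrableOn_Icc_of_le hN]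
  exact H.integrable_mulVec g.sqIntegrable

/-- The moment map `g ↦ ∫₀ᴺ H g`. -/
def moment : PreL2 H →ₗ[ℂ] Vec d where
  toFun g := ∫ x in Icc 0 N, H.mat x *ᵥ g x
  map_add' f g := by
    rw [← integral_add (H.integrable_mulVec f.sqIntegrable) (H.integrable_mulVec g.sqIntegrable)]
    simp only [coe_add, Pi.add_apply, mulVec_add]
  map_smul' c f := by
    rw [RingHom.id_apply, ← integral_smul]
    simp only [coe_smul, Pi.smul_apply, mulVec_smul]

theorem moment_apply (g : PreL2 H) : moment g = ∫ x in Icc 0 N, H.mat x *ᵥ g x := rfl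

/-- Used to turn a boundary term in `∫ H g` into the inner product of a constant correction with
`g`. -/
theorem inner_const (a : Vec d) (g : PreL2 H) : inner ℂ (const a) g = star a ⬝ᵥ moment g := by
  let L : Vec d →L[ℂ] ℂ := LinearMap.toContinuousLinearMap (dotProductBilin ℂ ℂ (star a))
  exact L.integral_comp_comm (H.integrable_mulVec g.sqIntegrable)

/-- Integration by parts: Green's identity for `J u' = H v` and `J f' = H g`. -/
theorem inner_sub_inner_eq (hN : 0 ≤ N) {u v f g : PreL2 H}
    (hu : AbsolutelyContinuousOnInterval u.toFun 0 N)
    (hf : AbsolutelyContinuousOnInterval f.toFun 0 N)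
    (huv : ∀ᵐ x ∂volume.restrict (Icc 0 N),
      DifferentiableAt ℝ u.toFun x ∧ J d *ᵥ deriv u.toFun x = H.mat x *ᵥ v x)
    (hfg : ∀ᵐ x ∂volume.restrict (Icc 0 N),
      DifferentiableAt ℝ f.toFun x ∧ J d *ᵥ deriv f.toFun x = H.mat x *ᵥ g x) :
    inner ℂ u g - inner ℂ v f =
      star (u N) ⬝ᵥ (J d *ᵥ f N) - star (u 0) ⬝ᵥ (J d *ᵥ f 0) := by
  have hug := H.integrable_form u.sqIntegrable g.sqIntegrable
  have hvf := H.integrable_form v.sqIntegrable f.sqIntegrable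
  have hAC : AbsolutelyContinuousOnInterval (fun x => star (u x) ⬝ᵥ (J d *ᵥ f x)) 0 N :=
    hu.star.dotProduct (hf.mulVec (J d))
  have hint : IntervalIntegrable (fun x => H.form u g x - H.form v f x) volume 0 N := by
    rw [intervalIntegrable_iff_integrableOn_Icc_of_le hN]
    exact hug.sub hvf
  rw [← hAC.integral_eq_sub_of_ae_hasDerivAt hint, intervalIntegral.integral_of_le hN,
    ← integral_Icc_eq_integral_Ioc, integral_sub hug hvf]
  · rfl
  rw [uIcc_of_le hN, ← ae_restrict_iff' measurableSet_Icc]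
  filter_upwards [huv, hfg, H.posSemidef] with x hx hy hH
  have h1 := (hx.1.hasDerivAt.star).dotProduct (hy.1.hasDerivAt.mulVec (J d))
  -- Skewness of `J` and Hermitian symmetry of `H` convert the derivative of `u^*` into `-v^* H`.
  have h2 : star (deriv u.toFun x) ⬝ᵥ (J d *ᵥ f x) = -H.form v f x := by
    rw [← neg_eq_iff_eq_neg, ← star_J_mulVec_dotProduct, hx.2, star_mulVec,
      hH.isHermitian.eq, ← dotProduct_mulVec]
    rfl
  rw [h2, hy.2, neg_add_eq_sub] at h1
  exact h1

/-- The function `x ↦ a - J ∫₀ˣ H g`, which solves `J u' = H g` with `u(0) = a`. -/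
def primitiveFun (a : Vec d) (g : PreL2 H) (x : ℝ) : Vec d :=
  a - J d *ᵥ ∫ t in (0 : ℝ)..x, H.mat t *ᵥ g t

theorem absolutelyContinuous_primitiveFun (hN : 0 ≤ N) (a : Vec d) (g : PreL2 H) :
    AbsolutelyContinuousOnInterval (primitiveFun a g) 0 N :=
  LipschitzWith.const a |>.lipschitzOnWith.absolutelyContinuousOnInterval.fun_sub <|
    (g.intervalIntegrable_mulVec hN).absolutelyContinuousOnInterval_integral.mulVec (J d)

/-- The solution of `J u' = H g` with `u(0) = a`, as an element of `PreL2 H`. -/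
def primitive (hN : 0 ≤ N) (a : Vec d) (g : PreL2 H) : PreL2 H :=
  ofContinuousOn (primitiveFun a g) <| by
    simpa [uIcc_of_le hN] using (absolutelyContinuous_primitiveFun hN a g).continuousOn

theorem absolutelyContinuous_primitive (hN : 0 ≤ N) (a : Vec d) (g : PreL2 H) :
    AbsolutelyContinuousOnInterval (primitive hN a g).toFun 0 N :=
  absolutelyContinuous_primitiveFun hN a g

theorem primitive_equation (hN : 0 ≤ N) (a : Vec d) (g : PreL2 H) :
    ∀ᵐ x ∂volume.restrict (Icc 0 N), DifferentiableAt ℝ (primitive hN a g).toFun x ∧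
      J d *ᵥ deriv (primitive hN a g).toFun x = H.mat x *ᵥ g x := by
  rw [ae_restrict_iff' measurableSet_Icc]
  filter_upwards [(g.intervalIntegrable_mulVec hN).ae_hasDerivAt_integral] with x hx hxm
  have h : HasDerivAt (primitive hN a g).toFun (-(J d *ᵥ (H.mat x *ᵥ g x))) x :=
    ((hx (by rwa [uIcc_of_le hN]) 0 left_mem_uIcc).mulVec (J d)).const_sub a
  exact ⟨h.differentiableAt, by rw [h.deriv, mulVec_neg, J_mulVec_J_mulVec, neg_neg]⟩

theorem primitive_zero (hN : 0 ≤ N) (a : Vec d) (g : PreL2 H) : primitive hN a g 0 = a := by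
  change a - J d *ᵥ (∫ t in (0 : ℝ)..0, H.mat t *ᵥ g t) = a
  simp

theorem primitive_right (hN : 0 ≤ N) (a : Vec d) (g : PreL2 H) :
    primitive hN a g N = a - J d *ᵥ moment g := by
  change a - J d *ᵥ (∫ t in (0 : ℝ)..N, H.mat t *ᵥ g t) = _
  rw [moment_apply, intervalIntegral.integral_of_le hN, integral_Icc_eq_integral_Ioc]

theorem primitive_eq_add_const (hN : 0 ≤ N) (a b : Vec d) (g : PreL2 H) :
    primitive hN (a + b) g = primitive hN a g + const b := by
  refine Subtype.ext (funext fun x => ?_)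
  change a + b - _ = a - _ + b
  exact add_sub_right_comm a b _

end PreL2

theorem inner_toL2 (f g : PreL2 H) : inner ℂ (H.toL2 f) (H.toL2 g) = inner ℂ f g :=
  SeparationQuotient.inner_mk_mk f g

end Hamiltonian

open Hamiltonian Hamiltonian.PreL2

/-! ### Lagrange multipliers and self-adjointness. -/

/-- A linear functional vanishing on the common kernel of two coordinate maps is a combination of
their coordinates. -/
theorem exists_star_dotProduct_of_ker_le {V ι κ : Type*} [AddCommGroup V] [Module ℂ V] [Fintype ι]
    [Fintype κ] (P : V →ₗ[ℂ] ι → ℂ) (Q : V →ₗ[ℂ] κ → ℂ) (φ : V →ₗ[ℂ] ℂ)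
    (h : ∀ x, P x = 0 → Q x = 0 → φ x = 0) :
    ∃ (s : ι → ℂ) (t : κ → ℂ), ∀ x, φ x = star s ⬝ᵥ P x + star t ⬝ᵥ Q x := by
  classical
  -- Purely algebraic duality: `V` may be infinite-dimensional and no continuity is required.
  have hφ : φ ∈ LinearMap.range (P.prod Q).dualMap := by
    rw [LinearMap.range_dualMap_eq_dualAnnihilator_ker, Submodule.mem_dualAnnihilator]
    intro x hx
    exact h x (congrArg Prod.fst hx) (congrArg Prod.snd hx)
  obtain ⟨ψ, rfl⟩ := hφ
  refine ⟨fun i => star (ψ (Pi.single i 1, 0)), fun j => star (ψ (0, Pi.single j 1)), fun x => ?_⟩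
  have h1 := (ψ ∘ₗ LinearMap.inl ℂ (ι → ℂ) (κ → ℂ)).pi_apply_eq_sum_univ (P x)
  have h2 := (ψ ∘ₗ LinearMap.inr ℂ (ι → ℂ) (κ → ℂ)).pi_apply_eq_sum_univ (Q x)
  have h3 : (P x, Q x) = (P x, 0) + (0, Q x) := by simp
  change ψ (P x, Q x) = _
  rw [h3, map_add]
  refine congrArg₂ _ (h1.trans ?_) (h2.trans ?_) <;>
  · refine Finset.sum_congr rfl fun i _ => ?_
    simp only [Pi.star_apply, star_star, smul_eq_mul, LinearMap.comp_apply, LinearMap.inl_apply,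
      LinearMap.inr_apply, mul_comm]
    congr 4
    funext j
    simp [Pi.single_apply, eq_comm]

variable {H : Hamiltonian d N} {θ₁ θ₂ β₁ β₂ : Matrix (Fin d) (Fin d) ℂ}

/-- The relation `T_{Θ,B}` is symmetric. -/
theorem boundaryRelation_le_adjoint (hN : 0 ≤ N) (hΘ : IsBoundaryMatrix θ₁ θ₂)
    (hB : IsBoundaryMatrix β₁ β₂) :
    boundaryRelation H θ₁ θ₂ β₁ β₂ ≤ (boundaryRelation H θ₁ θ₂ β₁ β₂).adjoint := by
  rintro ⟨_, _⟩ ⟨u, v, rfl, rfl, huv⟩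
  rw [Submodule.mem_adjoint_iff]
  rintro _ _ ⟨f, g, rfl, rfl, hfg⟩
  simp only [inner_toL2]
  have h := inner_sub_inner_eq hN hfg.absolutelyContinuous huv.absolutelyContinuous
    hfg.equation huv.equation
  rw [hB.star_dotProduct_J_mulVec_eq_zero hfg.right_boundary huv.right_boundary,
    hΘ.star_dotProduct_J_mulVec_eq_zero hfg.left_boundary huv.left_boundary, sub_zero] at h
  rw [← neg_sub, h, neg_zero]

/-- If `(h, k)` lies in the adjoint of `T_{Θ,B}`, then `h` differs from the solution `w` of
`J w' = H k` with `w(0) = 0` by a constant with prescribed boundary behaviour. -/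
theorem exists_multipliers (hN : 0 ≤ N) {h k : PreL2 H}
    (hk : (H.toL2 h, H.toL2 k) ∈ (boundaryRelation H θ₁ θ₂ β₁ β₂).adjoint) :
    ∃ s t : Fin d → ℂ, ∀ (a : Vec d) (g : PreL2 H),
      inner ℂ (primitive hN 0 k - h) g - star (primitive hN 0 k N) ⬝ᵥ (J d *ᵥ (a - J d *ᵥ moment g))
        = star s ⬝ᵥ (fromCols θ₁ θ₂ *ᵥ a) +
          star t ⬝ᵥ (fromCols β₁ β₂ *ᵥ (a - J d *ᵥ moment g)) := by
  set w := primitive hN 0 k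
  let A : Vec d × PreL2 H →ₗ[ℂ] Vec d := LinearMap.fst ℂ _ _
  -- `R` is the value at `N` of the solution with data `(a, g)`.
  let R : Vec d × PreL2 H →ₗ[ℂ] Vec d := A - (J d).mulVecLin ∘ₗ moment ∘ₗ LinearMap.snd ℂ _ _
  let φ : Vec d × PreL2 H →ₗ[ℂ] ℂ := (innerₛₗ ℂ (w - h)) ∘ₗ LinearMap.snd ℂ _ _ -
    dotProductBilin ℂ ℂ (star (w N)) ∘ₗ (J d).mulVecLin ∘ₗ R
  suffices hφ : ∀ x, ((fromCols θ₁ θ₂).mulVecLin ∘ₗ A) x = 0 →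
      ((fromCols β₁ β₂).mulVecLin ∘ₗ R) x = 0 → φ x = 0 by
    obtain ⟨s, t, hst⟩ := exists_star_dotProduct_of_ker_le _ _ φ hφ
    exact ⟨s, t, fun a g => hst (a, g)⟩
  rintro ⟨a, g⟩ (ha : fromCols θ₁ θ₂ *ᵥ a = 0)
    (hb : fromCols β₁ β₂ *ᵥ (a - J d *ᵥ moment g) = 0)
  change inner ℂ (w - h) g - star (w N) ⬝ᵥ (J d *ᵥ (a - J d *ᵥ moment g)) = 0
  have hsol : IsSolution H θ₁ θ₂ β₁ β₂ (primitive hN a g) g :=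
    ⟨absolutelyContinuous_primitive hN a g, primitive_equation hN a g, by rwa [primitive_zero],
      by rwa [primitive_right]⟩
  have h1 := (Submodule.mem_adjoint_iff _ _).1 hk (H.toL2 (primitive hN a g)) (H.toL2 g)
    ⟨primitive hN a g, g, rfl, rfl, hsol⟩
  simp only [inner_toL2] at h1
  have h2 : inner ℂ h g = inner ℂ k (primitive hN a g) := by
    rw [← inner_conj_symm h, ← inner_conj_symm k, sub_eq_zero.1 h1]
  have h3 := inner_sub_inner_eq hN (absolutelyContinuous_primitive hN 0 k)
    (absolutelyContinuous_primitive hN a g) (primitive_equation hN 0 k) (primitive_equation hN a g)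
  -- Since `w(0) = 0`, only the endpoint `N` contributes to Green's identity.
  rw [primitive_zero, primitive_right hN a g, star_zero, zero_dotProduct, sub_zero] at h3
  rw [inner_sub_left, h2, h3, sub_self]

/-- The adjoint of `T_{Θ,B}` is contained in `T_{Θ,B}`. -/
theorem adjoint_le_boundaryRelation (hN : 0 ≤ N) (hΘ : IsBoundaryMatrix θ₁ θ₂)
    (hB : IsBoundaryMatrix β₁ β₂) :
    (boundaryRelation H θ₁ θ₂ β₁ β₂).adjoint ≤ boundaryRelation H θ₁ θ₂ β₁ β₂ := by
  rintro ⟨p, q⟩ hpq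
  obtain ⟨h, rfl⟩ : ∃ h, H.toL2 h = p := SeparationQuotient.surjective_mk p
  obtain ⟨k, rfl⟩ : ∃ k, H.toL2 k = q := SeparationQuotient.surjective_mk q
  obtain ⟨s, t, hst⟩ := exists_multipliers hN hpq
  set w := primitive hN 0 k with hw
  set T := fromCols θ₁ θ₂ with hT
  set B := fromCols β₁ β₂ with hB'
  have hwN : J d *ᵥ w N = Tᴴ *ᵥ s + Bᴴ *ᵥ t := by
    have h1 : star (J d *ᵥ w N) = star (Tᴴ *ᵥ s + Bᴴ *ᵥ t) := by
      refine dotProduct_eq _ _ fun a => ?_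
      -- With `g = 0` the solution is the constant `a`, which isolates `w(N)`.
      have h2 := hst a 0
      simp only [map_zero, mulVec_zero, sub_zero, inner_zero_right, zero_sub] at h2
      rw [star_J_mulVec_dotProduct, h2, star_add, add_dotProduct, star_mulVec, star_mulVec,
        conjTranspose_conjTranspose, conjTranspose_conjTranspose, dotProduct_mulVec,
        dotProduct_mulVec]
    exact star_injective h1
  -- The new initial value: it lies in the kernel of `Θ`, and adding it to `w(N)` cancels the `Θ^*
  -- s` contribution.
  set r := J d *ᵥ (Tᴴ *ᵥ s) with hr
  have hrN : r + w N = -(J d *ᵥ (Bᴴ *ᵥ t)) := by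
    have h1 := congrArg (J d *ᵥ ·) hwN
    simp only [J_mulVec_J_mulVec, mulVec_add] at h1
    rw [← neg_eq_iff_eq_neg, neg_add, h1, hr]
    abel
  have hu : primitive hN r k = w + const r := by
    rw [hw, ← primitive_eq_add_const, zero_add]
  have hin : ∀ g : PreL2 H, inner ℂ (primitive hN r k - h) g = 0 := by
    intro g
    -- With `a = 0` the multiplier `t` and `w(N)` combine into the constant correction `r`.
    have h1 := hst 0 g
    simp only [zero_sub, mulVec_neg, J_mulVec_J_mulVec, neg_neg, mulVec_zero, dotProduct_zero,
      zero_add, dotProduct_neg] at h1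
    have h2 : star t ⬝ᵥ (B *ᵥ (J d *ᵥ moment g)) = star (r + w N) ⬝ᵥ moment g := by
      rw [hrN, star_neg, neg_dotProduct, star_J_mulVec_dotProduct, neg_neg, star_mulVec,
        conjTranspose_conjTranspose, ← dotProduct_mulVec]
    rw [h2, star_add, add_dotProduct] at h1
    rw [hu, add_sub_right_comm, inner_add_left, inner_const]
    linear_combination h1
  refine ⟨primitive hN r k, k, ?_, rfl, absolutelyContinuous_primitive hN r k,
    primitive_equation hN r k, ?_, ?_⟩
  -- Orthogonality to every `g` identifies the classes of `w + r` and `h`, though not the functions.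
  · refine ext_inner_right ℂ fun x => ?_
    obtain ⟨g, rfl⟩ : ∃ g, H.toL2 g = x := SeparationQuotient.surjective_mk x
    rw [inner_toL2, inner_toL2, ← sub_eq_zero, ← inner_sub_left, hin]
  · rw [primitive_zero]
    exact hΘ.mulVec_J_conjTranspose_mulVec s
  · have h1 : primitive hN r k N = r + w N := by
      rw [primitive_right, hw, primitive_right]
      abel
    rw [h1, hrN, mulVec_neg, hB.mulVec_J_conjTranspose_mulVec, neg_zero]

end CanonicalSystem

end
theorem theorem2p3 (d : ℕ) (N : ℝ) (hN : 0 < N) (H : CanonicalSystem.Hamiltonian d N)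
    (θ₁ θ₂ β₁ β₂ : Matrix (Fin d) (Fin d) ℂ)
    (hΘ : CanonicalSystem.IsBoundaryMatrix θ₁ θ₂)
    (hB : CanonicalSystem.IsBoundaryMatrix β₁ β₂) :
    CanonicalSystem.IsSelfAdjointRelation
      (CanonicalSystem.boundaryRelation H θ₁ θ₂ β₁ β₂) :=
  (CanonicalSystem.adjoint_le_boundaryRelation hN.le hΘ hB).antisymm
    (CanonicalSystem.boundaryRelation_le_adjoint hN.le hΘ hB)
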